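/- Let $n\ge 1$ be a fixed integer. For $N\ge n$ let $G$ be an $n\times N$ random matrix with independent standard Gaussian $\mathcal N(0,1)$ entries, and put $Y_N=\det(GG^*)^{1/2}$, where $G^*$ is the transpose of $G$. Then the following hold. (1) For each real $p\ge 2$ there is a constant $C_{n,p}>0$, depending only on $n$ and $p$, such that for every $N\ge n$, $$\mathbb E\,\bigl|Y_N^2-\mathbb E Y_N^2\bigr|^p\le C_{n,p}\,N^{p(n-\frac12)}$$ (in particular the expectations involved are finite). (2) The variance of $Y_N$ is finite and satisfies $$\frac{\operatorname{Var}(Y_N)}{N^{n-1}}\longrightarrow \frac n2\quad\text{as } N\to\infty.$$ (3) $Y_N^2$ is asymptotically normal: $$\sqrt N\left(\frac{Y_N^2}{N^n}-1\right)\longrightarrow \mathcal N(0,2n)\quad\text{in distribution as } N\to\infty,$$ where $\mathcal N(0,2n)$ is the Gaussian law with mean $0$ and variance $2n$. -/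

import Mathlib

open MeasureTheory ProbabilityTheory Filter Topology
open scoped NNReal ENNReal Matrix

universe u

/-- `G` is an `n × N` standard Gaussian random matrix on the probability space `(Ω, P)`:
its `n * N` entries are mutually independent, each with law `N(0,1)`. -/
structure IsStdGaussianMatrix {n N : ℕ} {Ω : Type*} [MeasurableSpace Ω]
    (G : Ω → Matrix (Fin n) (Fin N) ℝ) (P : Measure Ω) : Prop where
  hasLaw : ∀ i j, HasLaw (fun ω ↦ G ω i j) (gaussianReal 0 1) P
  indep : iIndepFun (fun (ij : Fin n × Fin N) ω ↦ G ω ij.1 ij.2) P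

/-- `det(A A*)^{1/2}` for a real `n × N` matrix `A`. -/
noncomputable def gramDetSqrt {n N : ℕ} (A : Matrix (Fin n) (Fin N) ℝ) : ℝ :=
  √((A * Aᵀ).det)

/-!
Write `ε = N ^ (-1/2)` and `G * Gᵀ / N = 1 + ε X`, where `X` is the fluctuation matrix
`gramFluctuation G`. Its entries are normalised sums over the `N` independent columns of centred
variables `g g' - δ` with finite exponential moments, so they are bounded in every `L^p`, uniformly
in `N` (`hasUniformMoments_gramFluctuation`).

Families bounded in every `L^p` form a ring (`uniformMomentsSubring`). Expanding the determinant
over that ring gives `det (1 + ε X) = 1 + ε Z` with `Z = tr X + ε R`, where the remainder `R` is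
automatically bounded in every `L^p` (`exists_det_mul_transpose_expansion`). Hence
`Y_N ^ 2 = N ^ n (1 + ε Z)`, and the three claims follow:

* the central moments of `Y_N ^ 2` are `N ^ (p (n - 1/2))` times those of `Z`;
* `√(1 + ε Z) = 1 + ε V`, where `2 V + ε V ^ 2 = Z`, so that `V = tr X / 2 + ε F` with `F` bounded
  in every `L^p` (`exists_gramDetSqrt_expansion`). Thus `Var Y_N / N ^ (n - 1) = Var V` tends to
  `Var (tr X) / 4 = n / 2`;
* `√N (Y_N ^ 2 / N ^ n - 1) = Z` differs from `tr X` by `ε R`, which is negligible in `L^1`, while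
  `tr X` is a normalised sum of `n N` independent copies of `g ^ 2 - 1`. The characteristic
  functions converge by the second-order expansion behind the central limit theorem, and
  Lévy's theorem concludes.
-/

/-! ### Families bounded in every `L^p` -/

section UniformMoments

variable {ι : Type*} {Ω : ι → Type*} [∀ i, MeasurableSpace (Ω i)]

/-- A family of random variables, each on its own probability space, is bounded in `L^p` for every
finite `p`, uniformly over the family. -/
def HasUniformMoments (P : ∀ i, Measure (Ω i)) (Z : ∀ i, Ω i → ℝ) : Prop :=
  (∀ i, AEStronglyMeasurable (Z i) (P i)) ∧
    ∀ p : ℝ≥0, ∃ C : ℝ≥0, ∀ i, eLpNorm (Z i) p (P i) ≤ C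

namespace HasUniformMoments

variable {P : ∀ i, Measure (Ω i)} {Z W : ∀ i, Ω i → ℝ}

lemma memLp (hZ : HasUniformMoments P Z) (i : ι) (p : ℝ≥0) : MemLp (Z i) p (P i) :=
  ⟨hZ.1 i, ((hZ.2 p).choose_spec i).trans_lt ENNReal.coe_lt_top⟩

lemma add (hZ : HasUniformMoments P Z) (hW : HasUniformMoments P W) :
    HasUniformMoments P (Z + W) := by
  refine ⟨fun i ↦ (hZ.1 i).add (hW.1 i), fun p ↦ ?_⟩
  obtain ⟨C, hC⟩ := hZ.2 p
  obtain ⟨D, hD⟩ := hW.2 p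
  have hL : ENNReal.LpAddConst (p : ℝ≥0∞) ≠ ⊤ := (ENNReal.LpAddConst_lt_top _).ne
  refine ⟨(ENNReal.LpAddConst (p : ℝ≥0∞)).toNNReal * (C + D), fun i ↦ ?_⟩
  refine (eLpNorm_add_le' (hZ.1 i) (hW.1 i) p).trans ?_
  push_cast
  rw [ENNReal.coe_toNNReal hL]
  gcongr
  exacts [hC i, hD i]

lemma mul (hZ : HasUniformMoments P Z) (hW : HasUniformMoments P W) :
    HasUniformMoments P (Z * W) := by
  refine ⟨fun i ↦ (hZ.1 i).mul (hW.1 i), fun p ↦ ?_⟩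
  obtain ⟨C, hC⟩ := hZ.2 (2 * p)
  obtain ⟨D, hD⟩ := hW.2 (2 * p)
  refine ⟨C * D, fun i ↦ ?_⟩
  have : ENNReal.HolderTriple ((2 * p : ℝ≥0) : ℝ≥0∞) ((2 * p : ℝ≥0) : ℝ≥0∞) (p : ℝ≥0∞) := by
    constructor
    push_cast
    rw [ENNReal.mul_inv (by simp) (by simp), ← add_mul, ENNReal.inv_two_add_inv_two, one_mul]
  refine (eLpNorm_smul_le_mul_eLpNorm (hW.1 i) (hZ.1 i)
    (p := ((2 * p : ℝ≥0) : ℝ≥0∞)) (q := ((2 * p : ℝ≥0) : ℝ≥0∞)) (r := p)).trans ?_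
  push_cast at hC hD ⊢
  gcongr
  exacts [hC i, hD i]

lemma neg (hZ : HasUniformMoments P Z) : HasUniformMoments P (-Z) :=
  ⟨fun i ↦ (hZ.1 i).neg, fun p ↦ (hZ.2 p).imp fun C hC i ↦ by
    simpa only [Pi.neg_apply, eLpNorm_neg] using hC i⟩

lemma mono (hZ : HasUniformMoments P Z) (hW : ∀ i, AEStronglyMeasurable (W i) (P i))
    (h : ∀ i ω, |W i ω| ≤ |Z i ω|) : HasUniformMoments P W :=
  ⟨hW, fun p ↦ (hZ.2 p).imp fun _ hC i ↦ (eLpNorm_mono (h i)).trans (hC i)⟩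

lemma of_bound [∀ i, IsProbabilityMeasure (P i)] {c : ι → ℝ} {C : ℝ} (h : ∀ i, |c i| ≤ C) :
    HasUniformMoments P (fun i _ ↦ c i) := by
  refine ⟨fun i ↦ aestronglyMeasurable_const, fun p ↦ ⟨C.toNNReal, fun i ↦ ?_⟩⟩
  refine (eLpNorm_le_of_ae_bound (C := C) (ae_of_all _ fun _ ↦ h i)).trans ?_
  simp [ENNReal.ofReal]

lemma of_integral_abs_rpow_le (hZ : ∀ i, AEStronglyMeasurable (Z i) (P i))
    (h : ∀ p : ℝ, 0 < p → ∃ C : ℝ, ∀ i, Integrable (fun ω ↦ |Z i ω| ^ p) (P i) ∧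
      ∫ ω, |Z i ω| ^ p ∂(P i) ≤ C) : HasUniformMoments P Z := by
  refine ⟨hZ, fun p ↦ ?_⟩
  rcases eq_zero_or_pos p with rfl | hp
  · exact ⟨0, by simp⟩
  have hp0 : (p : ℝ≥0∞) ≠ 0 := by simpa using hp.ne'
  obtain ⟨C, hC⟩ := h p hp
  refine ⟨(C ^ (p : ℝ)⁻¹).toNNReal, fun i ↦ ?_⟩
  have hm : MemLp (Z i) p (P i) := by
    rw [← integrable_norm_rpow_iff (hZ i) hp0 (by simp)]
    simpa using (hC i).1
  rw [hm.eLpNorm_eq_integral_rpow_norm hp0 (by simp)]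
  refine ENNReal.ofReal_le_ofReal ?_
  have := (hC i).2
  simp only [ENNReal.coe_toReal, Real.norm_eq_abs]
  gcongr

/-- Uniformly bounded two-sided exponential moments bound all moments uniformly. -/
lemma of_exp (hZ : ∀ i, AEStronglyMeasurable (Z i) (P i)) {s C : ℝ} (hs : 0 < s)
    (h : ∀ i, ∀ t, |t| = s → Integrable (fun ω ↦ Real.exp (t * Z i ω)) (P i) ∧
      ∫ ω, Real.exp (t * Z i ω) ∂(P i) ≤ C) : HasUniformMoments P Z := by
  refine of_integral_abs_rpow_le hZ fun p hp ↦ ⟨(p / s) ^ p * (C + C), fun i ↦ ?_⟩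
  obtain ⟨h1, h1'⟩ := h i s (abs_of_pos hs)
  obtain ⟨h2, h2'⟩ := h i (-s) (by rw [abs_neg, abs_of_pos hs])
  have hle : ∀ ω, |Z i ω| ^ p
      ≤ (p / s) ^ p * (Real.exp (s * Z i ω) + Real.exp (-s * Z i ω)) := fun ω ↦ by
    refine (rpow_abs_le_mul_max_exp (Z i ω) hp.le hs.ne').trans ?_
    rw [abs_of_pos hs]
    gcongr
    exact max_le_add_of_nonneg (Real.exp_pos _).le (Real.exp_pos _).le
  have hdom := (h1.add h2).const_mul ((p / s) ^ p)
  have hint : Integrable (fun ω ↦ |Z i ω| ^ p) (P i) := by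
    refine hdom.mono' ((hZ i).aemeasurable.abs.pow_const p).aestronglyMeasurable
      (ae_of_all _ fun ω ↦ ?_)
    rw [Real.norm_of_nonneg (by positivity)]
    exact hle ω
  refine ⟨hint, (integral_mono hint hdom hle).trans ?_⟩
  simp only [Pi.add_apply]
  rw [integral_const_mul, integral_add h1 h2]
  gcongr

lemma integral_abs_rpow_le (hZ : HasUniformMoments P Z) {p : ℝ} (hp : 0 < p) :
    ∃ C : ℝ, 0 < C ∧ ∀ i, Integrable (fun ω ↦ |Z i ω| ^ p) (P i) ∧
      ∫ ω, |Z i ω| ^ p ∂(P i) ≤ C := by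
  lift p to ℝ≥0 using hp.le
  have hp0 : (p : ℝ≥0∞) ≠ 0 := by simpa using (NNReal.coe_pos.1 hp).ne'
  obtain ⟨C, hC⟩ := hZ.2 p
  refine ⟨(C : ℝ) ^ (p : ℝ) + 1, by positivity, fun i ↦ ⟨?_, ?_⟩⟩
  · simpa using (hZ.memLp i p).integrable_norm_rpow hp0 (by simp)
  · have h := hC i
    rw [(hZ.memLp i p).eLpNorm_eq_integral_rpow_norm hp0 (by simp)] at h
    simp only [ENNReal.coe_toReal, Real.norm_eq_abs] at h
    have h0 : 0 ≤ ∫ ω, |Z i ω| ^ (p : ℝ) ∂(P i) := integral_nonneg fun ω ↦ by positivity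
    rw [← ENNReal.ofReal_coe_nnreal] at h
    have h := (ENNReal.ofReal_le_ofReal_iff C.2).1 h
    rw [Real.rpow_inv_le_iff_of_pos h0 C.2 hp] at h
    exact h.trans (le_add_of_nonneg_right zero_le_one)

lemma integral_bound (hZ : HasUniformMoments P Z) : ∃ C : ℝ, ∀ i, |∫ ω, Z i ω ∂(P i)| ≤ C := by
  obtain ⟨C, -, hC⟩ := hZ.integral_abs_rpow_le one_pos
  simp only [Real.rpow_one] at hC
  exact ⟨C, fun i ↦ (abs_integral_le_integral_abs).trans (hC i).2⟩

end HasUniformMoments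

/-- The ring of families of random variables that are uniformly bounded in every `L^p`, `p < ∞`. -/
def uniformMomentsSubring (P : ∀ i, Measure (Ω i)) [∀ i, IsProbabilityMeasure (P i)] :
    Subring (∀ i, Ω i → ℝ) where
  carrier := {Z | HasUniformMoments P Z}
  mul_mem' := HasUniformMoments.mul
  one_mem' := HasUniformMoments.of_bound (c := fun _ ↦ 1) (C := 1) (by simp)
  add_mem' := HasUniformMoments.add
  zero_mem' := HasUniformMoments.of_bound (c := fun _ ↦ 0) (C := 0) (by simp)
  neg_mem' := HasUniformMoments.neg

/-- First-order expansion of a determinant near the identity. Since the uniform moment bounds are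
stable under ring operations, expanding over the ring of such families bounds the remainder. -/
lemma HasUniformMoments.exists_det_one_add_smul {P : ∀ i, Measure (Ω i)}
    [∀ i, IsProbabilityMeasure (P i)] {n : ℕ} {X : ∀ i, Ω i → Matrix (Fin n) (Fin n) ℝ}
    (hX : ∀ j k, HasUniformMoments P (fun i ω ↦ X i ω j k)) {ε : ι → ℝ} {C : ℝ}
    (hε : ∀ i, |ε i| ≤ C) :
    ∃ R, HasUniformMoments P R ∧
      ∀ i ω, (1 + ε i • X i ω).det = 1 + ε i * (X i ω).trace + ε i ^ 2 * R i ω := by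
  let M : Matrix (Fin n) (Fin n) (uniformMomentsSubring P) :=
    Matrix.of fun j k ↦ ⟨fun i ω ↦ X i ω j k, hX j k⟩
  let r : uniformMomentsSubring P := ⟨fun i _ ↦ ε i, of_bound hε⟩
  have h := Matrix.det_one_add_smul r M
  set R : uniformMomentsSubring P := _root_.Polynomial.eval r _
  refine ⟨R.1, R.2, fun i ω ↦ ?_⟩
  let φ : uniformMomentsSubring P →+* ℝ :=
    (Pi.evalRingHom (fun _ : Ω i ↦ ℝ) ω).comp
      ((Pi.evalRingHom (fun i ↦ Ω i → ℝ) i).comp (uniformMomentsSubring P).subtype)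
  have hM : φ.mapMatrix M = X i ω := by ext; rfl
  have hr : φ r = ε i := rfl
  have key := congrArg φ h
  rw [RingHom.map_det] at key
  have h1 : φ.mapMatrix (1 + r • M) = 1 + ε i • X i ω := by
    rw [map_add, map_one, ← hM]
    congr 1
  have h2 : φ M.trace = (X i ω).trace := by
    simp only [Matrix.trace, Matrix.diag, map_sum]; rfl
  rw [h1, map_add, map_add, map_mul, map_mul, map_pow, h2, hr, map_one] at key
  rw [key, mul_comm (X i ω).trace, mul_comm (φ R)]
  rfl

end UniformMoments

/-! ### Exponential moments of sums of independent variables -/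

section Exponential

/-- Second-order bound on `exp (t x)`, with the factor `x ^ 2` absorbed into the exponential; the
quadratic dependence on `t` is what makes the product over `N ~ t ^ (-2)` factors bounded. -/
lemma exp_mul_le_one_add {s t : ℝ} (hs : 0 < s) (ht : |t| ≤ s) (x : ℝ) :
    Real.exp (t * x) ≤ 1 + t * x + 2 * (t / s) ^ 2 * Real.exp (2 * s * |x|) := by
  have h1 : Real.exp (t * x) - (1 + t * x) ≤ (t * x) ^ 2 * Real.exp |t * x| := by
    have h := Complex.norm_exp_sub_sum_le_norm_mul_exp ((t * x : ℝ) : ℂ) 2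
    have h' : Complex.exp ((t * x : ℝ) : ℂ) -
        ∑ m ∈ Finset.range 2, ((t * x : ℝ) : ℂ) ^ m / (m.factorial : ℂ)
        = ((Real.exp (t * x) - (1 + t * x) : ℝ) : ℂ) := by
      simp [Finset.sum_range_succ]
    rw [h', Complex.norm_real, Complex.norm_real, Real.norm_eq_abs, Real.norm_eq_abs, sq_abs] at h
    exact (le_abs_self _).trans h
  have h2 : (s * |x|) ^ 2 / 2 ≤ Real.exp (s * |x|) := by
    simpa using Real.pow_div_factorial_le_exp (s * |x|) (by positivity) 2
  have h3 : Real.exp |t * x| ≤ Real.exp (s * |x|) := by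
    rw [abs_mul]
    gcongr
  have h4 : (t * x) ^ 2 = 2 * (t / s) ^ 2 * ((s * |x|) ^ 2 / 2) := by
    rw [mul_pow s, sq_abs]
    field_simp
  have h5 : (t * x) ^ 2 * Real.exp |t * x|
      ≤ 2 * (t / s) ^ 2 * (Real.exp (s * |x|) * Real.exp (s * |x|)) := by
    rw [h4, mul_assoc (2 * (t / s) ^ 2)]
    gcongr
  rw [← Real.exp_add, ← two_mul, ← mul_assoc] at h5
  linarith

variable {Ω : Type*} [MeasurableSpace Ω] {P : Measure Ω}

lemma integrable_exp_mul_of_abs {s t : ℝ} {ξ : Ω → ℝ} (hξ : AEMeasurable ξ P)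
    (ht : |t| ≤ s) (h : Integrable (fun ω ↦ Real.exp (s * |ξ ω|)) P) :
    Integrable (fun ω ↦ Real.exp (t * ξ ω)) P := by
  refine h.mono' (hξ.const_mul t).exp.aestronglyMeasurable (ae_of_all _ fun ω ↦ ?_)
  rw [Real.norm_of_nonneg (Real.exp_pos _).le, Real.exp_le_exp]
  calc t * ξ ω ≤ |t| * |ξ ω| := by rw [← abs_mul]; exact le_abs_self _
    _ ≤ s * |ξ ω| := by gcongr

/-- A Bernstein-type bound: normalised sums of independent centred variables with a common
exponential moment bound inherit an exponential moment bound free of the number of terms. -/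
lemma ProbabilityTheory.iIndepFun.mgf_sum_le_of_exp_abs {κ : Type*} [Fintype κ]
    {ξ : κ → Ω → ℝ} (hind : iIndepFun ξ P) (hm : ∀ k, AEMeasurable (ξ k) P) {s t K : ℝ}
    (hs : 0 < s) (ht : |t| ≤ s) (hcard : Fintype.card κ * t ^ 2 ≤ s ^ 2)
    (h0 : ∀ k, ∫ ω, ξ k ω ∂P = 0)
    (hint : ∀ k, Integrable (fun ω ↦ Real.exp (2 * s * |ξ k ω|)) P) (hK0 : 0 ≤ K)
    (hK : ∀ k, ∫ ω, Real.exp (2 * s * |ξ k ω|) ∂P ≤ K) :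
    Integrable (fun ω ↦ Real.exp (t * ∑ k, ξ k ω)) P ∧
      ∫ ω, Real.exp (t * ∑ k, ξ k ω) ∂P ≤ Real.exp (2 * K) := by
  have := hind.isProbabilityMeasure
  have hexp : ∀ k, Integrable (fun ω ↦ Real.exp (t * ξ k ω)) P := fun k ↦
    integrable_exp_mul_of_abs (hm k) (ht.trans (by linarith)) (hint k)
  have hξ : ∀ k, Integrable (ξ k) P := fun k ↦ by
    refine ((hint k).const_mul (1 / (2 * s))).mono' (hm k).aestronglyMeasurable
      (ae_of_all _ fun ω ↦ ?_)
    have := Real.add_one_le_exp (2 * s * |ξ k ω|)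
    rw [Real.norm_eq_abs, one_div, inv_mul_eq_div, le_div_iff₀ (by positivity)]
    linarith
  have hmgf : mgf (∑ k, ξ k) P t = ∏ k, mgf (ξ k) P t := hind.mgf_sum₀ hm _
  have hpos : 0 < mgf (∑ k, ξ k) P t := by
    rw [hmgf]
    exact Finset.prod_pos fun k _ ↦ mgf_pos (hexp k)
  have hone : ∀ k, mgf (ξ k) P t ≤ Real.exp (2 * (t / s) ^ 2 * K) := fun k ↦ by
    have hi : Integrable (fun ω ↦ 1 + t * ξ k ω) P :=
      (integrable_const (1 : ℝ)).add ((hξ k).const_mul t)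
    have hi' := (hint k).const_mul (2 * (t / s) ^ 2)
    calc mgf (ξ k) P t
        ≤ ∫ ω, (1 + t * ξ k ω + 2 * (t / s) ^ 2 * Real.exp (2 * s * |ξ k ω|)) ∂P :=
          integral_mono (hexp k) (hi.add hi') fun ω ↦ exp_mul_le_one_add hs ht _
      _ = 1 + 2 * (t / s) ^ 2 * ∫ ω, Real.exp (2 * s * |ξ k ω|) ∂P := by
          rw [integral_add hi hi', integral_add (integrable_const (1 : ℝ)) ((hξ k).const_mul t),
            integral_const_mul, integral_const_mul, h0 k]
          simp
      _ ≤ 2 * (t / s) ^ 2 * K + 1 := by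
          rw [add_comm]
          gcongr
          exact hK k
      _ ≤ _ := Real.add_one_le_exp _
  have hfun : (fun ω ↦ Real.exp (t * ∑ k, ξ k ω)) = fun ω ↦ Real.exp (t * (∑ k, ξ k) ω) := by
    simp
  rw [hfun]
  refine ⟨?_, ?_⟩
  -- A positive Bochner integral is not the junk value, so the integrand is integrable.
  · by_contra hn
    exact hpos.ne' (integral_undef hn)
  · change mgf (∑ k, ξ k) P t ≤ _
    rw [hmgf]
    calc ∏ k, mgf (ξ k) P t ≤ ∏ _k : κ, Real.exp (2 * (t / s) ^ 2 * K) :=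
          Finset.prod_le_prod (fun k _ ↦ mgf_nonneg) fun k _ ↦ hone k
      _ = Real.exp (2 * (Fintype.card κ * t ^ 2 / s ^ 2) * K) := by
          rw [Finset.prod_const, ← Real.exp_nat_mul, Finset.card_univ]
          congr 1
          field_simp
      _ ≤ Real.exp (2 * 1 * K) := by
          gcongr
          rw [div_le_one (by positivity)]
          exact hcard
      _ = _ := by rw [mul_one]

/-- Disjoint blocks of an independent family are independent. -/
lemma ProbabilityTheory.iIndepFun.blocks {ι κ E : Type*} [Countable ι] [Countable κ]
    [MeasurableSpace E] {f : ι × κ → Ω → E} (hm : ∀ p, AEMeasurable (f p) P)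
    (h : iIndepFun f P) : iIndepFun (fun i ω k ↦ f (i, k) ω) P := by
  have := h.isProbabilityMeasure
  have : ∀ p, IsProbabilityMeasure (P.map (f p)) := fun p ↦
    Measure.isProbabilityMeasure_map (hm p)
  have hrow : ∀ i, AEMeasurable (fun ω k ↦ f (i, k) ω) P := fun i ↦
    aemeasurable_pi_iff.2 fun k ↦ hm (i, k)
  rw [iIndepFun_iff_map_fun_eq_infinitePi_map₀' hrow]
  have hblock : ∀ i, P.map (fun ω k ↦ f (i, k) ω)
      = Measure.infinitePi fun k ↦ P.map (f (i, k)) := fun i ↦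
    (h.precomp (g := fun k ↦ (i, k)) (Prod.mk_right_injective i)).map_fun_eq_infinitePi_map₀'
      fun k ↦ hm (i, k)
  simp_rw [hblock]
  rw [← Measure.infinitePi_map_curry (fun i k ↦ P.map (f (i, k))),
    ← h.map_fun_eq_infinitePi_map₀' hm,
    AEMeasurable.map_map_of_aemeasurable (MeasurableEquiv.measurable _).aemeasurable
      (aemeasurable_pi_iff.2 hm)]
  rfl

end Exponential

/-! ### Gaussian moments and the fluctuation matrix -/

section GaussianMoments

lemma integrable_pow_gaussianReal (m : ℕ) :
    Integrable (fun x : ℝ ↦ x ^ m) (gaussianReal 0 1) :=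
  integrable_pow_of_mem_interior_integrableExpSet (X := fun x ↦ x) (by simp) m

lemma integral_sq_gaussianReal : ∫ x : ℝ, x ^ 2 ∂(gaussianReal 0 1) = 1 := by
  have h := variance_fun_id_gaussianReal (μ := 0) (v := 1)
  rw [variance_eq_integral measurable_id'.aemeasurable] at h
  simpa using h

/-- The fourth derivative at `0` of the moment generating function `exp (t ^ 2 / 2)`. -/
lemma integral_pow_four_gaussianReal : ∫ x : ℝ, x ^ 4 ∂(gaussianReal 0 1) = 3 := by
  have h := iteratedDeriv_mgf_zero (X := fun x : ℝ ↦ x) (μ := gaussianReal 0 1) (by simp) 4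
  have h0 : ∀ t : ℝ, HasDerivAt (fun t : ℝ ↦ Real.exp (t ^ 2 / 2)) (t * Real.exp (t ^ 2 / 2)) t :=
    fun t ↦ by
      convert! ((hasDerivAt_pow 2 t).div_const 2).exp using 1
      push_cast
      ring
  have d0 : deriv (fun t : ℝ ↦ Real.exp (t ^ 2 / 2)) = fun t ↦ t * Real.exp (t ^ 2 / 2) :=
    funext fun t ↦ (h0 t).deriv
  have d1 : deriv (fun t : ℝ ↦ t * Real.exp (t ^ 2 / 2))
      = fun t ↦ (1 + t ^ 2) * Real.exp (t ^ 2 / 2) := funext fun t ↦ by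
    exact (((hasDerivAt_id' t).mul (h0 t)).congr_deriv (by ring)).deriv
  have d2 : deriv (fun t : ℝ ↦ (1 + t ^ 2) * Real.exp (t ^ 2 / 2))
      = fun t ↦ (3 * t + t ^ 3) * Real.exp (t ^ 2 / 2) := funext fun t ↦ by
    exact ((((hasDerivAt_pow 2 t).const_add 1).mul (h0 t)).congr_deriv
      (by push_cast; ring)).deriv
  have d3 : deriv (fun t : ℝ ↦ (3 * t + t ^ 3) * Real.exp (t ^ 2 / 2))
      = fun t ↦ (3 + 6 * t ^ 2 + t ^ 4) * Real.exp (t ^ 2 / 2) := funext fun t ↦ by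
    exact (((((hasDerivAt_id' t).const_mul 3).add (hasDerivAt_pow 3 t)).mul (h0 t)).congr_deriv
      (by push_cast; simp only [Pi.add_apply]; ring)).deriv
  rw [mgf_fun_id_gaussianReal] at h
  simp only [NNReal.coe_one, zero_mul, zero_add, one_mul] at h
  rw [iteratedDeriv_succ, iteratedDeriv_succ, iteratedDeriv_succ, iteratedDeriv_one, d0, d1, d2,
    d3] at h
  simpa using h.symm

lemma integral_sq_sub_one_gaussianReal : ∫ x : ℝ, (x ^ 2 - 1) ∂(gaussianReal 0 1) = 0 := by
  rw [integral_sub (integrable_pow_gaussianReal 2) (integrable_const _), integral_sq_gaussianReal]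
  simp

lemma integrable_sq_sub_one_sq_gaussianReal :
    Integrable (fun x : ℝ ↦ (x ^ 2 - 1) ^ 2) (gaussianReal 0 1) := by
  have : (fun x : ℝ ↦ (x ^ 2 - 1) ^ 2) = fun x ↦ x ^ 4 - 2 * x ^ 2 + 1 := by ext; ring
  rw [this]
  exact ((integrable_pow_gaussianReal 4).sub ((integrable_pow_gaussianReal 2).const_mul 2)).add
    (integrable_const _)

lemma integral_sq_sub_one_sq_gaussianReal :
    ∫ x : ℝ, (x ^ 2 - 1) ^ 2 ∂(gaussianReal 0 1) = 2 := by
  have : (fun x : ℝ ↦ (x ^ 2 - 1) ^ 2) = fun x ↦ x ^ 4 - 2 * x ^ 2 + 1 := by ext; ring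
  have hi : Integrable (fun x : ℝ ↦ x ^ 4 - 2 * x ^ 2) (gaussianReal 0 1) :=
    (integrable_pow_gaussianReal 4).sub ((integrable_pow_gaussianReal 2).const_mul 2)
  rw [this, integral_add hi (integrable_const _),
    integral_sub (integrable_pow_gaussianReal 4) ((integrable_pow_gaussianReal 2).const_mul 2),
    integral_const_mul, integral_sq_gaussianReal, integral_pow_four_gaussianReal]
  norm_num

lemma exists_integrable_exp_sq_gaussianReal :
    ∃ c : ℝ, 0 < c ∧ Integrable (fun x : ℝ ↦ Real.exp (c * x ^ 2)) (gaussianReal 0 1) := by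
  obtain ⟨c, hc, h⟩ := IsGaussian.exists_integrable_exp_sq (gaussianReal 0 1)
  exact ⟨c, hc, by simpa using h⟩

end GaussianMoments

namespace IsStdGaussianMatrix

section

variable {n N : ℕ} {Ω : Type*} [MeasurableSpace Ω] {P : Measure Ω}
  {G : Ω → Matrix (Fin n) (Fin N) ℝ}

lemma aemeasurable (hG : IsStdGaussianMatrix G P) (i : Fin n) (k : Fin N) :
    AEMeasurable (fun ω ↦ G ω i k) P := (hG.hasLaw i k).aemeasurable

lemma integrable_comp (hG : IsStdGaussianMatrix G P) {f : ℝ → ℝ}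
    (hf : Integrable f (gaussianReal 0 1)) (i : Fin n) (k : Fin N) :
    Integrable (fun ω ↦ f (G ω i k)) P := by
  rw [← (hG.hasLaw i k).map_eq] at hf
  exact hf.comp_aemeasurable (hG.aemeasurable i k)

lemma integral_comp (hG : IsStdGaussianMatrix G P) {f : ℝ → ℝ}
    (hf : Integrable f (gaussianReal 0 1)) (i : Fin n) (k : Fin N) :
    ∫ ω, f (G ω i k) ∂P = ∫ x, f x ∂(gaussianReal 0 1) :=
  (hG.hasLaw i k).integral_comp hf.1

lemma aemeasurable_gram_term (hG : IsStdGaussianMatrix G P) (i j : Fin n) (k : Fin N) :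
    AEMeasurable (fun ω ↦ G ω i k * G ω j k - (1 : Matrix (Fin n) (Fin n) ℝ) i j) P :=
  ((hG.aemeasurable i k).mul (hG.aemeasurable j k)).sub_const _

/-- The rank-one contributions of the columns of `G` to an entry of `G * Gᵀ` are independent. -/
lemma iIndepFun_gram_term (hG : IsStdGaussianMatrix G P) (i j : Fin n) :
    iIndepFun (fun k ω ↦ G ω i k * G ω j k - (1 : Matrix (Fin n) (Fin n) ℝ) i j) P := by
  have h := (hG.indep.precomp (g := Prod.swap) Prod.swap_injective).blocks
    (fun p ↦ hG.aemeasurable p.2 p.1)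
  exact h.comp (fun _ x ↦ x i * x j - (1 : Matrix (Fin n) (Fin n) ℝ) i j) fun _ ↦ by fun_prop

lemma integral_gram_term (hG : IsStdGaussianMatrix G P) (i j : Fin n) (k : Fin N) :
    ∫ ω, (G ω i k * G ω j k - (1 : Matrix (Fin n) (Fin n) ℝ) i j) ∂P = 0 := by
  have := hG.indep.isProbabilityMeasure
  by_cases hij : i = j
  · subst hij
    have h := hG.integral_comp ((integrable_pow_gaussianReal 2).sub (integrable_const 1)) i k
    simp only [Pi.sub_apply] at h
    rw [integral_sq_sub_one_gaussianReal] at h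
    simpa [sq] using h
  · have hi : IndepFun (fun ω ↦ G ω i k) (fun ω ↦ G ω j k) P :=
      hG.indep.indepFun (i := (i, k)) (j := (j, k)) (by simpa using hij)
    have h1 : ∫ ω, G ω i k ∂P = 0 := by
      simpa using (hG.hasLaw i k).integral_eq
    simp only [Matrix.one_apply_ne hij, sub_zero]
    rw [hi.integral_fun_mul_eq_mul_integral (hG.aemeasurable i k).aestronglyMeasurable
      (hG.aemeasurable j k).aestronglyMeasurable, h1, zero_mul]

/-- Exponential moments of `g g' - δ` come from those of `g ^ 2`, as
`|g g'| ≤ max (g ^ 2) (g' ^ 2)`. -/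
lemma exp_abs_gram_term (hG : IsStdGaussianMatrix G P) {c : ℝ} (hc : 0 < c)
    (hint : Integrable (fun x : ℝ ↦ Real.exp (c * x ^ 2)) (gaussianReal 0 1))
    (i j : Fin n) (k : Fin N) :
    Integrable (fun ω ↦ Real.exp
        (c * |G ω i k * G ω j k - (1 : Matrix (Fin n) (Fin n) ℝ) i j|)) P ∧
      ∫ ω, Real.exp (c * |G ω i k * G ω j k - (1 : Matrix (Fin n) (Fin n) ℝ) i j|) ∂P
        ≤ Real.exp c * (2 * ∫ x, Real.exp (c * x ^ 2) ∂(gaussianReal 0 1)) := by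
  have hle : ∀ ω, Real.exp (c * |G ω i k * G ω j k - (1 : Matrix (Fin n) (Fin n) ℝ) i j|)
      ≤ Real.exp c * (Real.exp (c * G ω i k ^ 2) + Real.exp (c * G ω j k ^ 2)) := fun ω ↦ by
    set x := G ω i k
    set y := G ω j k
    have hδ : |(1 : Matrix (Fin n) (Fin n) ℝ) i j| ≤ 1 := by
      rw [Matrix.one_apply]
      split_ifs <;> simp
    have h1 : |x * y| ≤ max (x ^ 2) (y ^ 2) := by
      rw [abs_mul]
      rcases le_total |x| |y| with h | h
      · refine le_max_of_le_right ?_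
        rw [← sq_abs y, sq]
        gcongr
      · refine le_max_of_le_left ?_
        rw [← sq_abs x, sq]
        gcongr
    have h2 : |x * y - (1 : Matrix (Fin n) (Fin n) ℝ) i j| ≤ 1 + max (x ^ 2) (y ^ 2) :=
      (abs_sub _ _).trans (by linarith)
    calc _ ≤ Real.exp (c * (1 + max (x ^ 2) (y ^ 2))) := by gcongr
      _ = Real.exp c * Real.exp (c * max (x ^ 2) (y ^ 2)) := by rw [← Real.exp_add]; ring_nf
      _ ≤ _ := by
        gcongr
        rcases max_cases (x ^ 2) (y ^ 2) with ⟨h, -⟩ | ⟨h, -⟩ <;> rw [h]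
        · exact le_add_of_nonneg_right (Real.exp_pos _).le
        · exact le_add_of_nonneg_left (Real.exp_pos _).le
  have hi := hG.integrable_comp hint i k
  have hj := hG.integrable_comp hint j k
  have hdom := (hi.add hj).const_mul (Real.exp c)
  have hI : Integrable (fun ω ↦ Real.exp
      (c * |G ω i k * G ω j k - (1 : Matrix (Fin n) (Fin n) ℝ) i j|)) P := by
    refine hdom.mono' ((hG.aemeasurable_gram_term i j k).abs.const_mul c).exp.aestronglyMeasurable
      (ae_of_all _ fun ω ↦ ?_)
    rw [Real.norm_of_nonneg (Real.exp_pos _).le]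
    exact hle ω
  refine ⟨hI, (integral_mono hI hdom hle).trans_eq ?_⟩
  simp only [Pi.add_apply]
  rw [integral_const_mul, integral_add hi hj, hG.integral_comp hint, hG.integral_comp hint, two_mul]

end

end IsStdGaussianMatrix

/-- The fluctuation matrix `√N (A * Aᵀ / N - 1)` of the normalised Gram matrix of an `n × N`
matrix `A`. For `N = 0` it is the zero matrix, since `(√0)⁻¹ = 0`. -/
noncomputable def gramFluctuation {n N : ℕ} (A : Matrix (Fin n) (Fin N) ℝ) :
    Matrix (Fin n) (Fin n) ℝ :=
  (√(N : ℝ))⁻¹ • (A * Aᵀ - (N : ℝ) • 1)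

section Fluctuation

variable {n N : ℕ}

lemma gramFluctuation_apply (A : Matrix (Fin n) (Fin N) ℝ) (i j : Fin n) :
    gramFluctuation A i j
      = (√(N : ℝ))⁻¹ * ∑ k, (A i k * A j k - (1 : Matrix (Fin n) (Fin n) ℝ) i j) := by
  simp [gramFluctuation, Matrix.mul_apply, Finset.sum_sub_distrib]

lemma trace_gramFluctuation (A : Matrix (Fin n) (Fin N) ℝ) :
    (gramFluctuation A).trace = (√(N : ℝ))⁻¹ * ∑ p : Fin n × Fin N, (A p.1 p.2 ^ 2 - 1) := by
  simp only [Matrix.trace, Matrix.diag, gramFluctuation_apply, ← Finset.mul_sum,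
    Fintype.sum_prod_type, Matrix.one_apply_eq, sq]

/-- The identity includes `N = 0`, where both sides vanish because `n` is positive. -/
lemma det_mul_transpose_eq (hn : 1 ≤ n) (A : Matrix (Fin n) (Fin N) ℝ) :
    (A * Aᵀ).det = (N : ℝ) ^ n * (1 + (√(N : ℝ))⁻¹ • gramFluctuation A).det := by
  have : Nonempty (Fin n) := ⟨⟨0, hn⟩⟩
  rcases Nat.eq_zero_or_pos N with rfl | hN
  · have h0 : A * Aᵀ = 0 := by ext; simp [Matrix.mul_apply]
    rw [h0, Matrix.det_zero, Nat.cast_zero, zero_pow (by omega), zero_mul]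
  · have hN' : (N : ℝ) ≠ 0 := by positivity
    have h : A * Aᵀ = (N : ℝ) • (1 + (√(N : ℝ))⁻¹ • gramFluctuation A) := by
      rw [gramFluctuation, smul_smul, ← mul_inv, Real.mul_self_sqrt (by positivity), smul_add,
        smul_smul, mul_inv_cancel₀ hN', one_smul]
      abel
    conv_lhs => rw [h]
    rw [Matrix.det_smul, Fintype.card_fin]

lemma abs_inv_sqrt_natCast_le_one (N : ℕ) : |(√(N : ℝ))⁻¹| ≤ 1 := by
  rw [abs_of_nonneg (by positivity)]
  rcases Nat.eq_zero_or_pos N with rfl | hN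
  · simp
  · exact inv_le_one_of_one_le₀ (Real.one_le_sqrt.2 (by exact_mod_cast hN))

end Fluctuation

section Family

variable {ι : Type*} {Ω : ι → Type*} [∀ a, MeasurableSpace (Ω a)] {P : ∀ a, Measure (Ω a)}
  {n : ℕ} {N : ι → ℕ} {G : ∀ a, Ω a → Matrix (Fin n) (Fin (N a)) ℝ}

lemma hasUniformMoments_gramFluctuation (hG : ∀ a, IsStdGaussianMatrix (G a) (P a)) (i j : Fin n) :
    HasUniformMoments P (fun a ω ↦ gramFluctuation (G a ω) i j) := by
  obtain ⟨c, hc, hint⟩ := exists_integrable_exp_sq_gaussianReal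
  simp only [gramFluctuation_apply]
  set K : ℝ := Real.exp c * (2 * ∫ x, Real.exp (c * x ^ 2) ∂(gaussianReal 0 1))
  have hK : 0 ≤ K := by
    have : 0 ≤ ∫ x, Real.exp (c * x ^ 2) ∂(gaussianReal 0 1) :=
      integral_nonneg fun x ↦ (Real.exp_pos _).le
    positivity
  refine HasUniformMoments.of_exp (s := c / 2) (C := Real.exp (2 * K)) (fun a ↦ ?_)
    (by positivity) fun a t ht ↦ ?_
  · exact ((Finset.aemeasurable_fun_sum _ fun k _ ↦
      (hG a).aemeasurable_gram_term i j k).const_mul _).aestronglyMeasurable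
  · have habs : |t * (√(N a : ℝ))⁻¹| ≤ c / 2 := by
      rw [abs_mul, ht]
      exact mul_le_of_le_one_right (by positivity) (abs_inv_sqrt_natCast_le_one _)
    have hcard : (Fintype.card (Fin (N a)) : ℝ) * (t * (√(N a : ℝ))⁻¹) ^ 2 ≤ (c / 2) ^ 2 := by
      rw [Fintype.card_fin, mul_pow, ← ht, sq_abs, inv_pow, Real.sq_sqrt (by positivity),
        mul_left_comm]
      exact mul_le_of_le_one_right (by positivity) mul_inv_le_one
    have h2c : 2 * (c / 2) = c := by ring
    have h := ((hG a).iIndepFun_gram_term i j).mgf_sum_le_of_exp_abs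
      (fun k ↦ (hG a).aemeasurable_gram_term i j k) (by positivity) habs hcard
      (fun k ↦ (hG a).integral_gram_term i j k)
      (fun k ↦ by rw [h2c]; exact ((hG a).exp_abs_gram_term hc hint i j k).1)
      hK
      (fun k ↦ by rw [h2c]; exact ((hG a).exp_abs_gram_term hc hint i j k).2)
    simpa only [mul_assoc] using h

variable [∀ a, IsProbabilityMeasure (P a)]

lemma hasUniformMoments_trace_gramFluctuation (hG : ∀ a, IsStdGaussianMatrix (G a) (P a)) :
    HasUniformMoments P (fun a ω ↦ (gramFluctuation (G a ω)).trace) := by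
  have h := (uniformMomentsSubring P).sum_mem (t := Finset.univ)
    (f := fun i a ω ↦ gramFluctuation (G a ω) i i)
    fun i _ ↦ hasUniformMoments_gramFluctuation hG i i
  have heq : (fun a ω ↦ (gramFluctuation (G a ω)).trace)
      = ∑ i, fun a ω ↦ gramFluctuation (G a ω) i i := by
    ext a ω
    simp [Matrix.trace]
  rw [heq]
  exact h

lemma exists_det_mul_transpose_expansion (hn : 1 ≤ n)
    (hG : ∀ a, IsStdGaussianMatrix (G a) (P a)) :
    ∃ R, HasUniformMoments P R ∧ ∀ a ω, (G a ω * (G a ω)ᵀ).det = (N a : ℝ) ^ n *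
      (1 + (√(N a : ℝ))⁻¹ * ((gramFluctuation (G a ω)).trace + (√(N a : ℝ))⁻¹ * R a ω)) := by
  obtain ⟨R, hR, h⟩ := HasUniformMoments.exists_det_one_add_smul
    (hasUniformMoments_gramFluctuation hG) (fun a ↦ abs_inv_sqrt_natCast_le_one (N a))
  refine ⟨R, hR, fun a ω ↦ ?_⟩
  rw [det_mul_transpose_eq hn, h]
  ring

end Family

/-! ### The trace term and the square root of the determinant -/

section TraceTerm

variable {n N : ℕ} {Ω : Type*} [MeasurableSpace Ω] {P : Measure Ω}
  {G : Ω → Matrix (Fin n) (Fin N) ℝ}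

lemma IsStdGaussianMatrix.variance_sq_sub_one [IsProbabilityMeasure P]
    (hG : IsStdGaussianMatrix G P) (i : Fin n) (k : Fin N) :
    MemLp (fun ω ↦ G ω i k ^ 2 - 1) 2 P ∧ variance (fun ω ↦ G ω i k ^ 2 - 1) P = 2 := by
  have hm : AEMeasurable (fun ω ↦ G ω i k ^ 2 - 1) P :=
    ((hG.aemeasurable i k).pow_const 2).sub_const 1
  refine ⟨(memLp_two_iff_integrable_sq hm.aestronglyMeasurable).2
    (hG.integrable_comp integrable_sq_sub_one_sq_gaussianReal i k), ?_⟩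
  have h0 : ∫ ω, (G ω i k ^ 2 - 1) ∂P = 0 :=
    (hG.integral_comp ((integrable_pow_gaussianReal 2).sub (integrable_const 1)) i k).trans
      integral_sq_sub_one_gaussianReal
  rw [variance_of_integral_eq_zero hm h0]
  exact (hG.integral_comp integrable_sq_sub_one_sq_gaussianReal i k).trans
    integral_sq_sub_one_sq_gaussianReal

/-- The variance `2n` of the limit law: `n` independent terms `g ^ 2 - 1` in each of the `N`
columns, each of variance `E g ^ 4 - 1 = 2`. -/
lemma IsStdGaussianMatrix.variance_trace_gramFluctuation [IsProbabilityMeasure P]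
    (hG : IsStdGaussianMatrix G P) (hN : 1 ≤ N) :
    variance (fun ω ↦ (gramFluctuation (G ω)).trace) P = 2 * n := by
  have hind : iIndepFun (fun (p : Fin n × Fin N) ω ↦ G ω p.1 p.2 ^ 2 - 1) P :=
    hG.indep.comp (fun _ x ↦ x ^ 2 - 1) fun _ ↦ by fun_prop
  have hsum : variance (∑ p : Fin n × Fin N, fun ω ↦ G ω p.1 p.2 ^ 2 - 1) P = n * N * 2 := by
    rw [IndepFun.variance_sum (fun p _ ↦ (hG.variance_sq_sub_one p.1 p.2).1)
      fun p _ q _ hpq ↦ hind.indepFun hpq]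
    simp [(hG.variance_sq_sub_one _ _).2]
  have hN' : (N : ℝ) ≠ 0 := by positivity
  simp only [trace_gramFluctuation]
  rw [variance_const_mul, inv_pow, Real.sq_sqrt (by positivity)]
  have : (fun ω ↦ ∑ p : Fin n × Fin N, (G ω p.1 p.2 ^ 2 - 1))
      = ∑ p : Fin n × Fin N, fun ω ↦ G ω p.1 p.2 ^ 2 - 1 := by
    ext ω
    simp
  rw [this, hsum]
  field_simp

/-- The trace is `√2` times a normalised sum of `n N` independent copies of `(g ^ 2 - 1) / √2`,
which has mean `0` and variance `1`. -/
lemma IsStdGaussianMatrix.charFun_trace_gramFluctuation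
    (hG : IsStdGaussianMatrix G P) (t : ℝ) :
    charFun (P.map fun ω ↦ (gramFluctuation (G ω)).trace) t
      = (charFun ((gaussianReal 0 1).map fun x ↦ (x ^ 2 - 1) / √2) ((√(N : ℝ))⁻¹ * (√2 * t)) ^ N)
        ^ n := by
  have hind : iIndepFun (fun (p : Fin n × Fin N) ω ↦ (G ω p.1 p.2 ^ 2 - 1) / √2) P :=
    hG.indep.comp (fun _ x ↦ (x ^ 2 - 1) / √2) fun _ ↦ by fun_prop
  have hm : ∀ p : Fin n × Fin N, AEMeasurable (fun ω ↦ (G ω p.1 p.2 ^ 2 - 1) / √2) P :=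
    fun p ↦ (((hG.aemeasurable p.1 p.2).pow_const 2).sub_const 1).div_const _
  have hlaw : ∀ p : Fin n × Fin N, P.map (fun ω ↦ (G ω p.1 p.2 ^ 2 - 1) / √2)
      = (gaussianReal 0 1).map fun x ↦ (x ^ 2 - 1) / √2 := fun p ↦ by
    rw [← (hG.hasLaw p.1 p.2).map_eq,
      AEMeasurable.map_map_of_aemeasurable (by fun_prop) (hG.aemeasurable p.1 p.2)]
    rfl
  have hT : (fun ω ↦ (gramFluctuation (G ω)).trace) = fun ω ↦
      ((√(N : ℝ))⁻¹ * √2) * ∑ p : Fin n × Fin N, (G ω p.1 p.2 ^ 2 - 1) / √2 := by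
    ext ω
    rw [trace_gramFluctuation, ← Finset.sum_div]
    field_simp
  rw [hT, charFun_map_mul_comp (Finset.aemeasurable_fun_sum _ fun p _ ↦ hm p),
    hind.charFun_map_fun_sum_eq_prod hm, Finset.prod_apply]
  simp_rw [hlaw]
  rw [Finset.prod_const, Finset.card_univ, Fintype.card_prod, Fintype.card_fin, Fintype.card_fin,
    mul_comm n N, pow_mul, mul_assoc]

end TraceTerm

lemma norm_charFun_map_sub_le {Ω : Type*} [MeasurableSpace Ω] {P : Measure Ω}
    [IsProbabilityMeasure P] {Z T : Ω → ℝ} (hZ : AEMeasurable Z P) (hT : AEMeasurable T P)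
    (hZT : Integrable (fun ω ↦ Z ω - T ω) P) (t : ℝ) :
    ‖charFun (P.map Z) t - charFun (P.map T) t‖ ≤ |t| * ∫ ω, |Z ω - T ω| ∂P := by
  have hcF : ∀ W : Ω → ℝ, AEMeasurable W P →
      charFun (P.map W) t = ∫ ω, Complex.exp (t * W ω * Complex.I) ∂P := fun W hW ↦ by
    rw [charFun_apply_real, integral_map hW (by fun_prop)]
  have hint : ∀ W : Ω → ℝ, AEMeasurable W P →
      Integrable (fun ω ↦ Complex.exp (t * W ω * Complex.I)) P := fun W hW ↦ by
    refine Integrable.of_bound (C := 1) (by fun_prop) (ae_of_all _ fun ω ↦ ?_)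
    rw [← Complex.ofReal_mul, Complex.norm_exp_ofReal_mul_I]
  rw [hcF Z hZ, hcF T hT, ← integral_sub (hint Z hZ) (hint T hT), ← integral_const_mul]
  refine norm_integral_le_of_norm_le (hZT.abs.const_mul |t|) (ae_of_all _ fun ω ↦ ?_)
  have h : Complex.exp (t * Z ω * Complex.I) - Complex.exp (t * T ω * Complex.I)
      = Complex.exp ((t * T ω : ℝ) * Complex.I) *
        (Complex.exp (Complex.I * (t * (Z ω - T ω) : ℝ)) - 1) := by
    rw [mul_sub, ← Complex.exp_add, mul_one]
    push_cast
    ring_nf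
  rw [h, norm_mul, Complex.norm_exp_ofReal_mul_I, one_mul, ← abs_mul]
  exact Real.norm_exp_I_mul_ofReal_sub_one_le

lemma tendsto_charFun_trace_gramFluctuation {n : ℕ} {Ω : ℕ → Type*}
    [∀ N, MeasurableSpace (Ω N)] {P : ∀ N, Measure (Ω N)}
    {G : ∀ N, Ω N → Matrix (Fin n) (Fin N) ℝ} (hG : ∀ N, IsStdGaussianMatrix (G N) (P N)) (t : ℝ) :
    Tendsto (fun N ↦ charFun ((P N).map fun ω ↦ (gramFluctuation (G N ω)).trace) t) atTop
      (𝓝 (charFun (gaussianReal 0 (2 * (n : ℝ≥0))) t)) := by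
  have h0 : ∫ x : ℝ, (x ^ 2 - 1) / √2 ∂(gaussianReal 0 1) = 0 := by
    rw [integral_div, integral_sq_sub_one_gaussianReal, zero_div]
  have h1 : ∫ x : ℝ, ((fun x ↦ (x ^ 2 - 1) / √2) ^ 2 : ℝ → ℝ) x ∂(gaussianReal 0 1) = 1 := by
    simp only [Pi.pow_apply, div_pow]
    rw [integral_div, integral_sq_sub_one_sq_gaussianReal]
    simp
  have h := (tendsto_charFun_inv_sqrt_mul_pow (X := fun x : ℝ ↦ (x ^ 2 - 1) / √2) (by fun_prop)
    h0 h1 (√2 * t)).pow n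
  simp only [(hG _).charFun_trace_gramFluctuation]
  convert h using 2
  rw [charFun_gaussianReal, ← Complex.exp_nat_mul]
  congr 1
  have h2 : ((√2 : ℝ) : ℂ) ^ 2 = 2 := by
    rw [← Complex.ofReal_pow, Real.sq_sqrt (by norm_num)]
    norm_num
  push_cast
  rw [mul_pow, h2]
  ring

lemma HasUniformMoments.covariance_bound {ι : Type*} {Ω : ι → Type*} [∀ i, MeasurableSpace (Ω i)]
    {P : ∀ i, Measure (Ω i)} [∀ i, IsProbabilityMeasure (P i)] {Z W : ∀ i, Ω i → ℝ}
    (hZ : HasUniformMoments P Z) (hW : HasUniformMoments P W) :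
    ∃ C : ℝ, ∀ i, |cov[Z i, W i; P i]| ≤ C := by
  obtain ⟨A, hA⟩ := (hZ.mul hW).integral_bound
  obtain ⟨B, hB⟩ := hZ.integral_bound
  obtain ⟨D, hD⟩ := hW.integral_bound
  refine ⟨A + B * D, fun i ↦ ?_⟩
  rw [covariance_eq_sub (hZ.memLp i 2) (hW.memLp i 2)]
  refine (abs_sub _ _).trans ?_
  rw [abs_mul]
  have hB0 : 0 ≤ B := (abs_nonneg _).trans (hB i)
  gcongr
  exacts [hA i, hB i, hD i]

section SquareRoot

variable {ι : Type*} {Ω : ι → Type*} [∀ a, MeasurableSpace (Ω a)] {P : ∀ a, Measure (Ω a)}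
  [∀ a, IsProbabilityMeasure (P a)] {n : ℕ} {N : ι → ℕ}
  {G : ∀ a, Ω a → Matrix (Fin n) (Fin (N a)) ℝ}

lemma gramDetSqrt_sq {n N : ℕ} (A : Matrix (Fin n) (Fin N) ℝ) :
    gramDetSqrt A ^ 2 = (A * Aᵀ).det := by
  refine Real.sq_sqrt ?_
  have h := (Matrix.posSemidef_self_mul_conjTranspose A).det_nonneg
  rwa [Matrix.conjTranspose_eq_transpose_of_trivial] at h

/-- If `1 + ε Z` is the normalised determinant then `√(1 + ε Z) = 1 + ε V` with
`V = Z / (1 + √(1 + ε Z))`, and `2 V + ε V ^ 2 = Z` gives `V` in terms of the trace. -/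
lemma exists_gramDetSqrt_expansion (hn : 1 ≤ n) (hG : ∀ a, IsStdGaussianMatrix (G a) (P a)) :
    ∃ V F, HasUniformMoments P V ∧ HasUniformMoments P F ∧ ∀ a ω,
      gramDetSqrt (G a ω) = √((N a : ℝ) ^ n) * (1 + (√(N a : ℝ))⁻¹ * V a ω) ∧
      V a ω = 1 / 2 * (gramFluctuation (G a ω)).trace + (√(N a : ℝ))⁻¹ * F a ω := by
  obtain ⟨R, hR, hdet⟩ := exists_det_mul_transpose_expansion hn hG
  have hT := hasUniformMoments_trace_gramFluctuation hG
  have hε : HasUniformMoments P (fun a _ ↦ (√(N a : ℝ))⁻¹) :=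
    .of_bound fun a ↦ abs_inv_sqrt_natCast_le_one (N a)
  let Z : ∀ a, Ω a → ℝ := fun a ω ↦
    (gramFluctuation (G a ω)).trace + (√(N a : ℝ))⁻¹ * R a ω
  have hZ : HasUniformMoments P Z := hT.add (hε.mul hR)
  let V : ∀ a, Ω a → ℝ := fun a ω ↦ Z a ω / (1 + √(1 + (√(N a : ℝ))⁻¹ * Z a ω))
  have hV : HasUniformMoments P V := by
    refine hZ.mono (fun a ↦ ?_) fun a ω ↦ ?_
    · have := (hZ.1 a).aemeasurable
      exact AEMeasurable.aestronglyMeasurable (by fun_prop)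
    · rw [abs_div]
      refine div_le_self (abs_nonneg _) ((le_abs_self _).trans' ?_)
      exact le_add_of_nonneg_right (Real.sqrt_nonneg _)
  have hhalf : HasUniformMoments P (fun _ _ ↦ (1 / 2 : ℝ)) := .of_bound fun _ ↦ le_rfl
  refine ⟨V, fun a ω ↦ 1 / 2 * (R a ω + -(V a ω * V a ω)), hV,
    hhalf.mul (hR.add (hV.mul hV).neg), fun a ω ↦ ?_⟩
  have hD : 0 ≤ 1 + (√(N a : ℝ))⁻¹ * Z a ω := by
    rcases Nat.eq_zero_or_pos (N a) with h | h
    -- Without columns `(√0)⁻¹ = 0`, so the radicand is `1`.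
    · simp [h]
    · have h0 : 0 ≤ (N a : ℝ) ^ n * (1 + (√(N a : ℝ))⁻¹ * Z a ω) := by
        rw [← hdet, ← gramDetSqrt_sq]
        positivity
      exact nonneg_of_mul_nonneg_right h0 (by positivity)
  have hsq := Real.sq_sqrt hD
  have hVdef : V a ω * (1 + √(1 + (√(N a : ℝ))⁻¹ * Z a ω)) = Z a ω :=
    div_mul_cancel₀ _ (by positivity)
  have hroot : √(1 + (√(N a : ℝ))⁻¹ * Z a ω) = 1 + (√(N a : ℝ))⁻¹ * V a ω := by
    have hpos : 0 < 1 + √(1 + (√(N a : ℝ))⁻¹ * Z a ω) := by positivity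
    refine mul_right_cancel₀ hpos.ne' ?_
    linear_combination hsq - (√(N a : ℝ))⁻¹ * hVdef
  refine ⟨?_, ?_⟩
  · rw [gramDetSqrt, hdet, Real.sqrt_mul (by positivity), ← hroot]
  · have hZa : Z a ω = (gramFluctuation (G a ω)).trace + (√(N a : ℝ))⁻¹ * R a ω := rfl
    rw [hroot] at hVdef
    linear_combination 1 / 2 * (hVdef + hZa)

end SquareRoot

/-! ### Moment bound, variance and limit law -/

/-- All standard Gaussian matrices with `n` rows and at least `n` columns, on all probability
spaces, gathered in one index type. A moment bound uniform over this index type has a constant that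
depends on `n` only. -/
structure StdGaussianMatrixModel (n : ℕ) where
  /-- the number of columns -/
  N : ℕ
  le : n ≤ N
  /-- the sample space -/
  Ω : Type u
  [mΩ : MeasurableSpace Ω]
  /-- the probability measure -/
  P : Measure Ω
  [prob : IsProbabilityMeasure P]
  /-- the random matrix -/
  G : Ω → Matrix (Fin n) (Fin N) ℝ
  isStd : IsStdGaussianMatrix G P

attribute [instance] StdGaussianMatrixModel.mΩ StdGaussianMatrixModel.prob

lemma exists_central_moment_bound (n : ℕ) (hn : 1 ≤ n) (p : ℝ) (hp : 2 ≤ p) :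
    ∃ C : ℝ, 0 < C ∧ ∀ a : StdGaussianMatrixModel.{u} n,
      Integrable (fun ω ↦ gramDetSqrt (a.G ω) ^ 2) a.P ∧
      Integrable (fun ω ↦
        |gramDetSqrt (a.G ω) ^ 2 - ∫ ω', gramDetSqrt (a.G ω') ^ 2 ∂a.P| ^ p) a.P ∧
      ∫ ω, |gramDetSqrt (a.G ω) ^ 2 - ∫ ω', gramDetSqrt (a.G ω') ^ 2 ∂a.P| ^ p ∂a.P
        ≤ C * (a.N : ℝ) ^ (p * ((n : ℝ) - 1 / 2)) := by
  let P : ∀ a : StdGaussianMatrixModel.{u} n, Measure a.Ω := fun a ↦ a.P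
  obtain ⟨R, hR, hdet⟩ := exists_det_mul_transpose_expansion (P := P) hn (fun a ↦ a.isStd)
  have hε : HasUniformMoments P (fun a _ ↦ (√(a.N : ℝ))⁻¹) :=
    .of_bound fun a ↦ abs_inv_sqrt_natCast_le_one a.N
  let Z : ∀ a : StdGaussianMatrixModel.{u} n, a.Ω → ℝ := fun a ω ↦
    (gramFluctuation (a.G ω)).trace + (√(a.N : ℝ))⁻¹ * R a ω
  have hZ : HasUniformMoments P Z :=
    (hasUniformMoments_trace_gramFluctuation fun a ↦ a.isStd).add (hε.mul hR)
  obtain ⟨B, hB⟩ := hZ.integral_bound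
  let W : ∀ a : StdGaussianMatrixModel.{u} n, a.Ω → ℝ := fun a ω ↦ Z a ω + -∫ ω', Z a ω' ∂a.P
  have hW : HasUniformMoments P W := hZ.add (HasUniformMoments.of_bound (P := P) hB).neg
  obtain ⟨C, hC0, hC⟩ := hW.integral_abs_rpow_le (p := p) (by linarith)
  refine ⟨C, hC0, fun a ↦ ?_⟩
  have hN : 0 < (a.N : ℝ) := by exact_mod_cast hn.trans a.le
  have hZi : Integrable (Z a) a.P := memLp_one_iff_integrable.1 (hZ.memLp a 1)
  have hY : ∀ ω, gramDetSqrt (a.G ω) ^ 2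
      = (a.N : ℝ) ^ n * (1 + (√(a.N : ℝ))⁻¹ * Z a ω) := fun ω ↦ by
    rw [gramDetSqrt_sq]
    exact hdet a ω
  have hYi : Integrable (fun ω ↦ (a.N : ℝ) ^ n * (1 + (√(a.N : ℝ))⁻¹ * Z a ω)) a.P :=
    ((integrable_const (1 : ℝ)).add (hZi.const_mul _)).const_mul _
  have hE : ∫ ω, (a.N : ℝ) ^ n * (1 + (√(a.N : ℝ))⁻¹ * Z a ω) ∂a.P
      = (a.N : ℝ) ^ n * (1 + (√(a.N : ℝ))⁻¹ * ∫ ω, Z a ω ∂a.P) := by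
    rw [integral_const_mul, integral_add (integrable_const _) (hZi.const_mul _),
      integral_const_mul]
    simp
  have hpow : (a.N : ℝ) ^ n * (√(a.N : ℝ))⁻¹ = (a.N : ℝ) ^ ((n : ℝ) - 1 / 2) := by
    rw [Real.rpow_sub hN, Real.rpow_natCast, ← Real.sqrt_eq_rpow, div_eq_mul_inv]
  have hkey : ∀ ω, |(a.N : ℝ) ^ n * (1 + (√(a.N : ℝ))⁻¹ * Z a ω)
      - (a.N : ℝ) ^ n * (1 + (√(a.N : ℝ))⁻¹ * ∫ ω, Z a ω ∂a.P)| ^ p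
      = (a.N : ℝ) ^ (p * ((n : ℝ) - 1 / 2)) * |W a ω| ^ p := fun ω ↦ by
    have : (a.N : ℝ) ^ n * (1 + (√(a.N : ℝ))⁻¹ * Z a ω)
        - (a.N : ℝ) ^ n * (1 + (√(a.N : ℝ))⁻¹ * ∫ ω, Z a ω ∂a.P)
        = (a.N : ℝ) ^ ((n : ℝ) - 1 / 2) * W a ω := by
      rw [← hpow]
      ring
    rw [this, abs_mul, abs_of_pos (by positivity), Real.mul_rpow (by positivity) (abs_nonneg _),
      ← Real.rpow_mul hN.le, mul_comm p]
  simp only [hY, hE, hkey]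
  refine ⟨hYi, (hC a).1.const_mul _, ?_⟩
  rw [integral_const_mul, mul_comm]
  gcongr
  exact (hC a).2

section Sequence

variable {n : ℕ} {Ω : ℕ → Type*} [∀ N, MeasurableSpace (Ω N)] {P : ∀ N, Measure (Ω N)}
  [∀ N, IsProbabilityMeasure (P N)] {G : ∀ N, Ω N → Matrix (Fin n) (Fin N) ℝ}

lemma tendsto_inv_sqrt_natCast : Tendsto (fun N : ℕ ↦ (√(N : ℝ))⁻¹) atTop (𝓝 0) :=
  tendsto_inv_atTop_zero.comp (Real.tendsto_sqrt_atTop.comp tendsto_natCast_atTop_atTop)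

lemma memLp_gramDetSqrt (hn : 1 ≤ n) (hG : ∀ N, IsStdGaussianMatrix (G N) (P N)) (N : ℕ) :
    MemLp (fun ω ↦ gramDetSqrt (G N ω)) 2 (P N) := by
  obtain ⟨V, F, hV, hF, h⟩ := exists_gramDetSqrt_expansion hn hG
  simp only [fun ω ↦ (h N ω).1]
  exact ((memLp_const (1 : ℝ)).add ((hV.memLp N 2).const_mul _)).const_mul _

lemma tendsto_variance_gramDetSqrt (hn : 1 ≤ n) (hG : ∀ N, IsStdGaussianMatrix (G N) (P N)) :
    Tendsto (fun N : ℕ ↦ variance (fun ω ↦ gramDetSqrt (G N ω)) (P N) / (N : ℝ) ^ (n - 1))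
      atTop (𝓝 ((n : ℝ) / 2)) := by
  obtain ⟨V, F, hV, hF, h⟩ := exists_gramDetSqrt_expansion hn hG
  have hT : HasUniformMoments P (fun N ω ↦ 1 / 2 * (gramFluctuation (G N ω)).trace) :=
    (HasUniformMoments.of_bound (c := fun _ ↦ (1 / 2 : ℝ)) fun _ ↦ le_rfl).mul
      (hasUniformMoments_trace_gramFluctuation hG)
  obtain ⟨A, hA⟩ := hT.covariance_bound hF
  obtain ⟨B, hB⟩ := hF.covariance_bound hF
  have hvar : ∀ N : ℕ, 1 ≤ N →
      variance (fun ω ↦ gramDetSqrt (G N ω)) (P N) / (N : ℝ) ^ (n - 1)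
      = n / 2 + ((√(N : ℝ))⁻¹ *
          (2 * cov[fun ω ↦ 1 / 2 * (gramFluctuation (G N ω)).trace, F N; P N])
        + (√(N : ℝ))⁻¹ * ((√(N : ℝ))⁻¹ * cov[F N, F N; P N])) := fun N hN ↦ by
    have hN' : (N : ℝ) ≠ 0 := by positivity
    have hVvar : variance (V N) (P N) = n / 2 + ((√(N : ℝ))⁻¹ *
          (2 * cov[fun ω ↦ 1 / 2 * (gramFluctuation (G N ω)).trace, F N; P N])
        + (√(N : ℝ))⁻¹ * ((√(N : ℝ))⁻¹ * cov[F N, F N; P N])) := by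
      have hVN : V N = fun ω ↦ 1 / 2 * (gramFluctuation (G N ω)).trace + (√(N : ℝ))⁻¹ * F N ω :=
        funext fun ω ↦ (h N ω).2
      rw [hVN, variance_fun_add (hT.memLp N 2) ((hF.memLp N 2).const_mul _),
        variance_const_mul, variance_const_mul, (hG N).variance_trace_gramFluctuation hN,
        covariance_const_mul_right, covariance_self (hF.1 N).aemeasurable]
      ring
    rw [← hVvar]
    simp only [fun ω ↦ (h N ω).1]
    rw [variance_const_mul, variance_const_add ((hV.1 N).const_mul _), variance_const_mul,
      Real.sq_sqrt (by positivity), inv_pow, Real.sq_sqrt (by positivity)]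
    obtain ⟨m, rfl⟩ : ∃ m, n = m + 1 := ⟨n - 1, by omega⟩
    rw [Nat.add_sub_cancel, pow_succ]
    field_simp
  have hlim : Tendsto (fun N : ℕ ↦ (n : ℝ) / 2 + ((√(N : ℝ))⁻¹ *
          (2 * cov[fun ω ↦ 1 / 2 * (gramFluctuation (G N ω)).trace, F N; P N])
        + (√(N : ℝ))⁻¹ * ((√(N : ℝ))⁻¹ * cov[F N, F N; P N]))) atTop (𝓝 ((n : ℝ) / 2)) := by
    have h1 : Tendsto (fun N : ℕ ↦ (√(N : ℝ))⁻¹ *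
        (2 * cov[fun ω ↦ 1 / 2 * (gramFluctuation (G N ω)).trace, F N; P N])) atTop (𝓝 0) := by
      refine tendsto_inv_sqrt_natCast.zero_mul_isBoundedUnder_le
        (isBoundedUnder_of ⟨2 * A, fun N ↦ ?_⟩)
      simpa using hA N
    have h2 : Tendsto (fun N : ℕ ↦ (√(N : ℝ))⁻¹ * ((√(N : ℝ))⁻¹ * cov[F N, F N; P N])) atTop
        (𝓝 0) := by
      refine tendsto_inv_sqrt_natCast.zero_mul_isBoundedUnder_le
        (isBoundedUnder_of ⟨B, fun N ↦ ?_⟩)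
      simp only [Function.comp_apply, Real.norm_eq_abs, abs_mul]
      exact (mul_le_of_le_one_left (abs_nonneg _) (abs_inv_sqrt_natCast_le_one N)).trans (hB N)
    simpa using (h1.add h2).const_add ((n : ℝ) / 2)
  refine hlim.congr' ?_
  filter_upwards [eventually_ge_atTop 1] with N hN using (hvar N hN).symm

lemma tendstoInDistribution_gramDetSqrt_sq (hn : 1 ≤ n)
    (hG : ∀ N, IsStdGaussianMatrix (G N) (P N)) :
    TendstoInDistribution
      (fun (N : ℕ) (ω : Ω N) ↦ √(N : ℝ) * (gramDetSqrt (G N ω) ^ 2 / (N : ℝ) ^ n - 1))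
      atTop (id : ℝ → ℝ) P (gaussianReal 0 (2 * (n : ℝ≥0))) := by
  have hm : ∀ N : ℕ, AEMeasurable
      (fun ω ↦ √(N : ℝ) * (gramDetSqrt (G N ω) ^ 2 / (N : ℝ) ^ n - 1)) (P N) := fun N ↦ by
    have := (memLp_gramDetSqrt hn hG N).1.aemeasurable
    fun_prop
  obtain ⟨R, hR, hdet⟩ := exists_det_mul_transpose_expansion hn hG
  have hT := hasUniformMoments_trace_gramFluctuation hG
  obtain ⟨C, -, hC⟩ := hR.integral_abs_rpow_le one_pos
  simp only [Real.rpow_one] at hC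
  refine ⟨hm, by fun_prop, ProbabilityMeasure.tendsto_iff_tendsto_charFun.2 fun t ↦ ?_⟩
  simp only [ProbabilityMeasure.coe_mk, Measure.map_id]
  refine (tendsto_charFun_trace_gramFluctuation hG t).congr_dist ?_
  refine squeeze_zero' (.of_forall fun _ ↦ dist_nonneg) ?_
    (by simpa using tendsto_inv_sqrt_natCast.const_mul (|t| * C))
  filter_upwards [eventually_ge_atTop 1] with N hN
  have hN' : 0 < (N : ℝ) := by exact_mod_cast hN
  have heq : ∀ ω, √(N : ℝ) * (gramDetSqrt (G N ω) ^ 2 / (N : ℝ) ^ n - 1)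
      - (gramFluctuation (G N ω)).trace = (√(N : ℝ))⁻¹ * R N ω := fun ω ↦ by
    rw [gramDetSqrt_sq, hdet N ω]
    have : √(N : ℝ) ≠ 0 := by positivity
    field_simp
    ring
  have hRi : Integrable (R N) (P N) := memLp_one_iff_integrable.1 (hR.memLp N 1)
  rw [dist_comm, dist_eq_norm]
  refine (norm_charFun_map_sub_le (hm N) (hT.1 N).aemeasurable ?_ t).trans ?_
  · simp only [heq]
    exact hRi.const_mul _
  · simp only [heq, abs_mul]
    rw [integral_const_mul, abs_of_nonneg (by positivity : 0 ≤ (√(N : ℝ))⁻¹),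
      mul_assoc, mul_comm C]
    gcongr
    exact (hC N).2

end Sequence

theorem proposition4p3 (n : ℕ) (hn : 1 ≤ n) :
    -- (1) central moments of `Y_N ^ 2`, with a constant depending only on `n` and `p`
    (∀ p : ℝ, 2 ≤ p → ∃ C : ℝ, 0 < C ∧
      ∀ (N : ℕ), n ≤ N →
      ∀ (Ω : Type u) [MeasurableSpace Ω] (P : Measure Ω) [IsProbabilityMeasure P]
        (G : Ω → Matrix (Fin n) (Fin N) ℝ), IsStdGaussianMatrix G P →
        Integrable (fun ω ↦ gramDetSqrt (G ω) ^ 2) P ∧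
        Integrable (fun ω ↦
          |gramDetSqrt (G ω) ^ 2 - ∫ ω', gramDetSqrt (G ω') ^ 2 ∂P| ^ p) P ∧
        ∫ ω, |gramDetSqrt (G ω) ^ 2 - ∫ ω', gramDetSqrt (G ω') ^ 2 ∂P| ^ p ∂P
          ≤ C * (N : ℝ) ^ (p * ((n : ℝ) - 1 / 2))) ∧
    -- (2), (3) for every sequence of `n × N` standard Gaussian matrices, `N → ∞`
    (∀ (Ω : ℕ → Type u) [∀ N, MeasurableSpace (Ω N)] (P : ∀ N, Measure (Ω N))
        [∀ N, IsProbabilityMeasure (P N)] (G : ∀ N, Ω N → Matrix (Fin n) (Fin N) ℝ),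
        (∀ N, IsStdGaussianMatrix (G N) (P N)) →
        -- (2) asymptotics of the (finite) variance of `Y_N`
        ((∀ N, MemLp (fun ω ↦ gramDetSqrt (G N ω)) 2 (P N)) ∧
          Tendsto (fun N : ℕ ↦
            variance (fun ω ↦ gramDetSqrt (G N ω)) (P N) / (N : ℝ) ^ (n - 1))
            atTop (𝓝 ((n : ℝ) / 2))) ∧
        -- (3) asymptotic normality of `Y_N ^ 2`; the limit has mean `0` and variance `2 n`
        TendstoInDistribution
          (fun (N : ℕ) (ω : Ω N) ↦ √(N : ℝ) * (gramDetSqrt (G N ω) ^ 2 / (N : ℝ) ^ n - 1))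
          atTop (id : ℝ → ℝ) P (gaussianReal 0 (2 * (n : ℝ≥0)))) := by
  refine ⟨fun p hp ↦ ?_, fun Ω _ P _ G hG ↦ ⟨⟨memLp_gramDetSqrt hn hG,
    tendsto_variance_gramDetSqrt hn hG⟩, tendstoInDistribution_gramDetSqrt_sq hn hG⟩⟩
  obtain ⟨C, hC0, hC⟩ := exists_central_moment_bound n hn p hp
  exact ⟨C, hC0, fun N hN Ω _ P _ G hG ↦ hC ⟨N, hN, Ω, P, G, hG⟩⟩
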